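/- Let $\mathbb T=\mathbb R/\mathbb Z$ with its quotient distance $|\cdot-\cdot|$, and for $N\ge 1$ give $\mathbb T^N$ its Lebesgue probability measure. For $\boldsymbol x\in\mathbb T^N$ and an index $i$, write $\hat{\boldsymbol x}_i$ for the coordinates of $\boldsymbol x$ other than the $i$-th one, and $\boldsymbol x=(x_i;\hat{\boldsymbol x}_i)$. For $a>0$ let $\mathcal V_a$ be the cone of functions $\psi\in C^2(\mathbb T,(0,\infty))$ with $|(\log\psi)'(x)|<a$ for all $x$, and let $\theta_a$ be its Hilbert projective metric, $\theta_a(v,w)=\log\beta_a(v,w)+\log\beta_a(w,v)$ with $\beta_a(v,w)=\inf\{t>0:\ tw-v\in\mathcal V_a\}$. For $0<a\le b$ and $L\ge 0$ let $\mathcal M_{a,b,L}(\mathbb T^N)$ be the set of measures $\mu$ on $\mathbb T^N$ that have a measurable density $\rho:\mathbb T^N\to(0,\infty)$ with respect to Lebesgue measure whose conditional densities $$\rho_{\hat{\boldsymbol x}_i}(s)=\frac{\rho(s;\hat{\boldsymbol x}_i)}{\int_{\mathbb T}\rho(t;\hat{\boldsymbol x}_i)\,dt}$$ satisfy, for all indices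 $i$ and $j\neq i$: (i) $\rho_{\hat{\boldsymbol x}_i}\in\mathcal V_a$ for every $\hat{\boldsymbol x}_i\in\mathbb T^{N-1}$; (ii) $\theta_b(\rho_{\hat{\boldsymbol x}_i},\rho_{\hat{\boldsymbol x}_i'})\le L\,|x_j-x_j'|$ for all $\hat{\boldsymbol x}_i,\hat{\boldsymbol x}_i'\in\mathbb T^{N-1}$ that differ only in their $j$-th coordinates $x_j,x_j'$. **Theorem.** Fix $0<a\le b$. There is a constant $K>0$, depending only on $a$ and $b$, such that for every integer $N\ge 1$, every probability measure $\mu\in\mathcal M_{a,b,N^{-1}}(\mathbb T^N)$ and every Lebesgue integrable $g:\mathbb T^N\to\mathbb R$ with $$\sup\{|g(x_j;\hat{\boldsymbol x}_j)-g(x_j';\hat{\boldsymbol x}_j)|:\ x_j,x_j'\in\mathbb T,\ \hat{\boldsymbol x}_j\in\mathbb T^{N-1}\}\le N^{-1}\qquad\text{for every } j,$$ the function $g$ is $\mu$-integrable and, for every $\varepsilon>0$, $$\mu\bigl(|g-\mathbb E_\mu[g]|\ge\varepsilon\bigr)\le 2\exp\left[-\frac{\varepsilon^2N}{1+KN^{-1}}\right].$$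 -/

import Mathlib

open MeasureTheory
open scoped ENNReal

/-- The torus `𝕋^N`, where `𝕋 = ℝ/ℤ`. Its `volume` is Lebesgue measure (of total mass one). -/
abbrev Torus (N : ℕ) : Type := Fin N → UnitAddCircle

/-- The cone `𝒱_a` of positive `C²` functions on `𝕋` with `|(log ψ)'| < a`. Derivatives on `𝕋`
are taken through the covering `ℝ → ℝ/ℤ`. -/
def logLipCone (a : ℝ) : Set (UnitAddCircle → ℝ) :=
  {ψ | ContDiff ℝ 2 (fun t : ℝ => ψ (t : UnitAddCircle)) ∧ (∀ x, 0 < ψ x) ∧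
    ∀ t : ℝ, |deriv (fun s : ℝ => Real.log (ψ (s : UnitAddCircle))) t| < a}

/-- `β(v, w) = inf {t > 0 : t w - v ∈ V}` for a cone `V` in a real vector space. -/
noncomputable def coneBeta {E : Type*} [AddCommGroup E] [Module ℝ E] (V : Set E) (v w : E) : ℝ :=
  sInf {t : ℝ | 0 < t ∧ t • w - v ∈ V}

/-- The Hilbert projective metric of a cone, `θ(v, w) = log β(v, w) + log β(w, v)`. -/
noncomputable def hilbertMetric {E : Type*} [AddCommGroup E] [Module ℝ E] (V : Set E)
    (v w : E) : ℝ :=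
  Real.log (coneBeta V v w) + Real.log (coneBeta V w v)

/-- The density of the conditional measure on the fibre through `x` in the direction of the
`i`-th coordinate, for a measure with density `ρ`:
`s ↦ ρ(s; x̂_i) / ∫ ρ(t; x̂_i) dt`. It does not depend on `x i`. -/
noncomputable def condDensity {N : ℕ} (ρ : Torus N → ℝ) (i : Fin N) (x : Torus N) :
    UnitAddCircle → ℝ :=
  fun s => ρ (Function.update x i s) / ∫ t : UnitAddCircle, ρ (Function.update x i t)

/-- The density `ρ` satisfies the conditions that define `𝓜_{a,b,L}^{(i,j)}`. -/
def IsLipDisintegrated {N : ℕ} (a b L : ℝ) (i j : Fin N) (ρ : Torus N → ℝ) : Prop :=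
  (∀ x : Torus N, condDensity ρ i x ∈ logLipCone a) ∧
  ∀ x x' : Torus N, (∀ l, l ≠ i → l ≠ j → x l = x' l) →
    hilbertMetric (logLipCone b) (condDensity ρ i x) (condDensity ρ i x') ≤ L * dist (x j) (x' j)

/-- `𝓜_{a,b,L}(𝕋^N)`: absolutely continuous measures whose (positive) density satisfies the
conditions of `𝓜_{a,b,L}^{(i,j)}` for all `i` and all `j ≠ i`. -/
def quasiProductMeasures (N : ℕ) (a b L : ℝ) : Set (Measure (Torus N)) :=
  {μ | ∃ ρ : Torus N → ℝ, Measurable ρ ∧ (∀ x, 0 < ρ x) ∧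
    μ = volume.withDensity (fun x => ENNReal.ofReal (ρ x)) ∧
    ∀ i j : Fin N, j ≠ i → IsLipDisintegrated a b L i j ρ}

/-- The oscillation of `ψ` with respect to the `j`-th coordinate, as an extended number. -/
noncomputable def coordOsc {N : ℕ} (ψ : Torus N → ℝ) (j : Fin N) : ℝ≥0∞ :=
  ⨆ (x : Torus N) (s : UnitAddCircle) (s' : UnitAddCircle),
    ENNReal.ofReal |ψ (Function.update x j s) - ψ (Function.update x j s')|

/-- `𝓞_α(𝕋^N)`: Lebesgue integrable functions whose oscillation with respect to every
coordinate is at most `α`. -/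
def smallOsc (N : ℕ) (α : ℝ) : Set (Torus N → ℝ) :=
  {ψ | (∀ j, coordOsc ψ j ≤ ENNReal.ofReal α) ∧ Integrable ψ volume}

/-!
The theorem holds with `K = 1`, by McDiarmid's method of bounded differences adapted to a density
`ρ` whose coordinates are weakly coupled.

Measure the coupling by cross ratios. If `v`, `w` are two conditional densities in the `i`-th
coordinate whose conditioning points differ in one coordinate `j`, then the Hilbert metric bounds
the oscillation of `log (v / w)` (`mul_le_exp_hilbertMetric_mul`). The normalizing integrals cancel,
and, as the circle has diameter `1 / 2`, all cross ratios
`ρ(s, t) ρ(s', t') / (ρ(s', t) ρ(s, t'))` in the coordinates `i ≠ j` are at most `exp (1 / (2 N))`.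
So `ρ` is `η`-weakly coupled (`IsWeaklyCoupled`) with `η = 1 / (2 N)`: see
`isWeaklyCoupled_of_isLipDisintegrated`. The parameters `a`, `b` only serve to make the infimum that
defines the Hilbert metric run over a nonempty set and to bound `ρ`.

Weak coupling survives the integration of one coordinate, with `1 - η` replaced by
`(1 - η) (1 - η ^ 2)` (`integral_cross_ratio`), so that the marginal with `n` coordinates is
`1 / (N + n)`-weakly coupled. The conditional mean of a function with coordinate oscillations at
most `c`, given the remaining coordinates, has oscillations at most `c (1 + η)`
(`mean_le_mean_add_of_ratio`). Integrating out the coordinates one after the other, with Hoeffding's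
lemma at each step, gives
`∫ exp (r (g - E g)) dμ ≤ exp (r ^ 2 S / 8)`, where `S` is the sum of the squared oscillations
that occur. Both recursions have closed forms, and for initial oscillations `1 / N` they give
`S ≤ (2 N + 1) / (N (N + 1)) ≤ 2 / N` (`IsWeaklyCoupled.integral_exp_mul_le`). Chernoff's bound
with `r = 2 N ε` then yields `exp (-ε ^ 2 N)` for each tail. For `N = 1`, where there is no pair of
coordinates, the inequality is immediate.

The fibre integrals in the induction require a Borel function, while `g` is only Lebesgue
measurable and its oscillation bounds hold at every point. Averages of `g` over small balls are
Borel, inherit the oscillation bounds, and converge to `g` almost everywhere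
(`exists_measurable_approx`), so that the exponential moment bound passes to `g`.
-/

/-! ### Functions of bounded coordinate oscillation -/

section Oscillation

variable {X : Type*} {n : ℕ}

/-- Changing a single coordinate increases `g` by at most `c`. -/
def HasCoordOscLE (c : ℝ) (g : (Fin n → X) → ℝ) : Prop :=
  ∀ i x s s', g (Function.update x i s) ≤ g (Function.update x i s') + c

lemma HasCoordOscLE.le_add {c : ℝ} {g : (Fin n → X) → ℝ} (hg : HasCoordOscLE c g)
    (x y : Fin n → X) : g x ≤ g y + n * c := by
  classical
  -- Replace the coordinates of `y` by those of `x` one at a time.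
  have key : ∀ S : Finset (Fin n), g (S.piecewise x y) ≤ g y + S.card * c := by
    intro S
    induction S using Finset.induction_on with
    | empty => simp
    | insert j S hj ih =>
      rw [Finset.piecewise_insert, Finset.card_insert_of_notMem hj]
      have h := hg j (S.piecewise x y) (x j) (S.piecewise x y j)
      rw [Function.update_eq_self] at h
      push_cast
      linarith
  simpa using key Finset.univ

lemma HasCoordOscLE.exists_abs_le {c : ℝ} {g : (Fin n → X) → ℝ} [Nonempty X]
    (hg : HasCoordOscLE c g) : ∃ B, ∀ x, |g x| ≤ B := by
  obtain ⟨y⟩ : Nonempty (Fin n → X) := inferInstance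
  refine ⟨|g y| + n * c, fun x => ?_⟩
  have h1 := hg.le_add x y
  have h2 := hg.le_add y x
  rw [abs_le]
  constructor <;> linarith [neg_abs_le (g y), le_abs_self (g y)]

lemma HasCoordOscLE.const_mul {c r : ℝ} {g : (Fin n → X) → ℝ} (hr : 0 ≤ r)
    (hg : HasCoordOscLE c g) : HasCoordOscLE (r * c) (fun x => r * g x) := by
  intro i x s s'
  have := mul_le_mul_of_nonneg_left (hg i x s s') hr
  simpa [mul_add] using this

lemma HasCoordOscLE.neg {c : ℝ} {g : (Fin n → X) → ℝ} (hg : HasCoordOscLE c g) :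
    HasCoordOscLE c (fun x => -g x) := by
  intro i x s s'
  linarith [hg i x s' s]

end Oscillation

section WeakCoupling

variable {X : Type*} [MeasureSpace X] [IsProbabilityMeasure (volume : Measure X)] {n : ℕ}

lemma isProbabilityMeasure_volume_pi :
    IsProbabilityMeasure (volume : Measure (Fin n → X)) :=
  inferInstanceAs (IsProbabilityMeasure (Measure.pi fun _ : Fin n => (volume : Measure X)))

/-! ### One-coordinate estimates -/

lemma integrable_of_measurable_of_abs_le {Y : Type*} [MeasureSpace Y]
    [IsProbabilityMeasure (volume : Measure Y)] {f : Y → ℝ} {B : ℝ} (hf : Measurable f)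
    (hB : ∀ y, |f y| ≤ B) : Integrable f volume :=
  Integrable.of_bound hf.aestronglyMeasurable B (Filter.Eventually.of_forall hB)

lemma integral_pos_of_forall_pos {Y : Type*} [MeasureSpace Y]
    [IsProbabilityMeasure (volume : Measure Y)] {f : Y → ℝ} (hf : Integrable f volume)
    (hpos : ∀ y, 0 < f y) : 0 < ∫ y, f y := by
  rw [integral_pos_iff_support_of_nonneg (fun y => (hpos y).le) hf]
  have : Function.support f = Set.univ := by
    ext y; simp [(hpos y).ne']
  simp [this]

/-- Hoeffding's lemma for the probability measure with density proportional to `p`. -/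
lemma integral_exp_mul_le_of_osc {p f : X → ℝ} {c : ℝ} (hp : Integrable p volume)
    (hpos : ∀ t, 0 < p t) (hf : Measurable f) (hosc : ∀ t t', f t ≤ f t' + c) :
    ∫ t, Real.exp (f t) * p t ≤
      (∫ t, p t) * Real.exp ((∫ t, f t * p t) / (∫ t, p t) + c ^ 2 / 8) := by
  have hZ : 0 < ∫ t, p t := integral_pos_of_forall_pos hp hpos
  have : Nonempty X := nonempty_of_isProbabilityMeasure (volume : Measure X)
  obtain ⟨t₀⟩ := this
  have hexp : ∀ t, Real.exp (Real.log (p t)) = p t := fun t => Real.exp_log (hpos t)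
  have hprob : IsProbabilityMeasure ((volume : Measure X).tilted fun t => Real.log (p t)) :=
    isProbabilityMeasure_tilted (by simpa only [hexp] using hp)
  have hint : ∀ h : X → ℝ, ∫ t, h t ∂((volume : Measure X).tilted fun t => Real.log (p t)) =
      (∫ t, h t * p t) / ∫ t, p t := by
    intro h
    rw [integral_tilted, ← integral_div]
    simp only [hexp, smul_eq_mul]
    congr 1; ext t; ring
  have hbdd : BddBelow (Set.range f) := ⟨f t₀ - c, by
    rintro _ ⟨t, rfl⟩; linarith [hosc t₀ t]⟩
  have hc : 0 ≤ c := by linarith [hosc t₀ t₀]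
  have hIcc : ∀ t, f t ∈ Set.Icc (⨅ t, f t) ((⨅ t, f t) + c) := by
    intro t
    have : Nonempty X := ⟨t₀⟩
    refine ⟨ciInf_le hbdd t, ?_⟩
    have : f t - c ≤ ⨅ t, f t := le_ciInf fun t' => by linarith [hosc t t']
    linarith
  have hsub := (ProbabilityTheory.hasSubgaussianMGF_of_mem_Icc (hf.aemeasurable)
    (Filter.Eventually.of_forall hIcc)
    (μ := (volume : Measure X).tilted fun t => Real.log (p t))).mgf_le 1
  simp only [ProbabilityTheory.mgf, hint, one_mul] at hsub
  have hcoe : (((‖(⨅ t, f t) + c - ⨅ t, f t‖₊ / 2) ^ 2 : NNReal) : ℝ) * 1 ^ 2 / 2 = c ^ 2 / 8 := by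
    push_cast
    rw [add_sub_cancel_left, Real.norm_eq_abs, div_pow, sq_abs]
    ring
  rw [hcoe, div_le_iff₀ hZ] at hsub
  have hsplit : ∫ t, Real.exp (f t - (∫ t, f t * p t) / ∫ t, p t) * p t =
      Real.exp (-((∫ t, f t * p t) / ∫ t, p t)) * ∫ t, Real.exp (f t) * p t := by
    rw [← integral_const_mul]
    congr 1; ext t
    rw [sub_eq_add_neg, Real.exp_add]; ring
  rw [hsplit, Real.exp_neg, inv_mul_le_iff₀ (Real.exp_pos _)] at hsub
  rw [Real.exp_add]
  linarith

/-- Two weights `p`, `q` whose likelihood ratio is constant up to a factor `1 - η` give means of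
`f ≤ h + c` and `h` that differ by at most `c (1 + η)`, when `h` oscillates by at most `c`. The
normalized weights satisfy `p ≥ (1 - η) q`, so that they are `η`-close in total variation. -/
lemma mean_le_mean_add_of_ratio {p q f h : X → ℝ} {c η B : ℝ} (hp : Integrable p volume)
    (hq : Integrable q volume) (hppos : ∀ t, 0 < p t) (hqpos : ∀ t, 0 < q t)
    (hf : Measurable f) (hh : Measurable h) (hfB : ∀ t, |f t| ≤ B) (hhB : ∀ t, |h t| ≤ B)
    (hfh : ∀ t, f t ≤ h t + c) (hosc : ∀ t t', h t ≤ h t' + c) (hη : 0 ≤ η)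
    (hratio : ∀ t t', (1 - η) * (p t' * q t) ≤ p t * q t') :
    (∫ t, f t * p t) / (∫ t, p t) ≤ (∫ t, h t * q t) / (∫ t, q t) + c * (1 + η) := by
  have hP : 0 < ∫ t, p t := integral_pos_of_forall_pos hp hppos
  have hQ : 0 < ∫ t, q t := integral_pos_of_forall_pos hq hqpos
  have hfp : Integrable (fun t => f t * p t) volume :=
    hp.bdd_mul hf.aestronglyMeasurable (Filter.Eventually.of_forall hfB)
  have hhp : Integrable (fun t => h t * p t) volume :=
    hp.bdd_mul hh.aestronglyMeasurable (Filter.Eventually.of_forall hhB)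
  have hhq : Integrable (fun t => h t * q t) volume :=
    hq.bdd_mul hh.aestronglyMeasurable (Filter.Eventually.of_forall hhB)
  have hpq : ∀ t, (1 - η) * ((∫ t, p t) * q t) ≤ p t * ∫ t, q t := by
    intro t
    have := integral_mono ((hp.mul_const (q t)).const_mul (1 - η)) (hq.const_mul (p t))
      (fun t' => hratio t t')
    simpa only [integral_const_mul, integral_mul_const] using this
  have : Nonempty X := nonempty_of_isProbabilityMeasure (volume : Measure X)
  obtain ⟨t₀⟩ := id this
  have hbdd : BddBelow (Set.range h) := ⟨-B, by
    rintro _ ⟨t, rfl⟩; exact (abs_le.1 (hhB t)).1⟩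
  set l := ⨅ t, h t with hl
  have hlow : ∀ t, l ≤ h t := fun t => ciInf_le hbdd t
  have hup : ∀ t, h t ≤ l + c := by
    intro t
    have : h t - c ≤ l := le_ciInf fun t' => by linarith [hosc t t']
    linarith
  -- The nonnegative function `l + c - h` has a `p`-mean at least `1 - η` times its `q`-mean.
  have hw : (1 - η) * (∫ t, p t) * ((l + c) * (∫ t, q t) - ∫ t, h t * q t) ≤
      ((l + c) * (∫ t, p t) - ∫ t, h t * p t) * ∫ t, q t := by
    have := integral_mono (((hq.const_mul (l + c)).sub hhq).const_mul ((1 - η) * ∫ t, p t))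
      (((hp.const_mul (l + c)).sub hhp).mul_const (∫ t, q t)) (fun t => by
        have := mul_le_mul_of_nonneg_left (hpq t) (sub_nonneg.2 (hup t))
        simp only [Pi.sub_apply]
        nlinarith [this])
    simp only [integral_const_mul, integral_mul_const, Pi.sub_apply] at this
    rwa [integral_sub (hq.const_mul _) hhq, integral_sub (hp.const_mul _) hhp,
      integral_const_mul, integral_const_mul] at this
  have hfle : ∫ t, f t * p t ≤ (∫ t, h t * p t) + c * ∫ t, p t := by
    rw [← integral_const_mul, ← integral_add hhp (hp.const_mul c)]
    refine integral_mono hfp (hhp.add (hp.const_mul c)) fun t => ?_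
    have := mul_le_mul_of_nonneg_right (hfh t) (hppos t).le
    linarith
  have hql : l * ∫ t, q t ≤ ∫ t, h t * q t := by
    rw [← integral_const_mul]
    exact integral_mono (hq.const_mul l) hhq fun t =>
      mul_le_mul_of_nonneg_right (hlow t) (hqpos t).le
  generalize (∫ t, f t * p t) = F at *
  generalize (∫ t, h t * p t) = G at *
  generalize (∫ t, h t * q t) = H at *
  generalize (∫ t, p t) = P at *
  generalize (∫ t, q t) = Q at *
  have hH : l ≤ H / Q := by rwa [le_div_iff₀ hQ]
  have hG : G / P ≤ (l + c) - (1 - η) * ((l + c) - H / Q) := by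
    rw [div_le_iff₀ hP]
    have hHQ : H = H / Q * Q := by field_simp
    rw [hHQ] at hw
    have : (1 - η) * P * (l + c - H / Q) ≤ (l + c) * P - G := by
      refine le_of_mul_le_mul_right ?_ hQ
      linarith
    linarith
  have hF : F / P ≤ G / P + c := by
    rw [div_add' _ _ _ hP.ne', div_le_div_iff_of_pos_right hP]
    exact hfle
  nlinarith [mul_nonneg hη (sub_nonneg.2 hH)]

/-- Integrating out a coordinate `t`: if `A`, `B`, `C`, `D` satisfy the cross-ratio bound with
`1 - η` pointwise, and the ratios `A / D` and `B / D` are constant up to a factor `1 - η`, then the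
integrals satisfy the cross-ratio bound with `(1 - η) (1 - η ^ 2)`. -/
lemma integral_cross_ratio {A B C D : X → ℝ} {η : ℝ} (hA : Integrable A volume)
    (hB : Integrable B volume) (hC : Integrable C volume) (hD : Integrable D volume)
    (hDpos : ∀ t, 0 < D t) (hη : η ≤ 1)
    (hABCD : ∀ t, (1 - η) * (A t * B t) ≤ C t * D t)
    (hAD : ∀ t t', (1 - η) * (A t * D t') ≤ A t' * D t)
    (hBD : ∀ t t', (1 - η) * (B t * D t') ≤ B t' * D t) :
    (1 - η) * (1 - η ^ 2) * ((∫ t, A t) * ∫ t, B t) ≤ (∫ t, C t) * ∫ t, D t := by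
  have hZ : 0 < ∫ t, D t := integral_pos_of_forall_pos hD hDpos
  have hA' : ∀ t, (1 - η) * ((∫ t, A t) * D t) ≤ A t * ∫ t, D t := by
    intro t
    have := integral_mono ((hA.mul_const (D t)).const_mul (1 - η)) (hD.const_mul (A t))
      (fun t' => hAD t' t)
    simpa only [integral_const_mul, integral_mul_const] using this
  have hB' : ∀ t, (1 - η) * ((∫ t, B t) * D t) ≤ B t * ∫ t, D t := by
    intro t
    have := integral_mono ((hB.mul_const (D t)).const_mul (1 - η)) (hD.const_mul (B t))
      (fun t' => hBD t' t)
    simpa only [integral_const_mul, integral_mul_const] using this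
  -- The product of the two nonnegative differences above bounds `A B` from below by an expression
  -- which is linear in `A`, `B`, `D` once divided by `D`.
  have key : ∀ t, (1 - η) * (((1 - η) * (∫ t, D t) * (∫ t, A t)) * B t
      + ((1 - η) * (∫ t, D t) * (∫ t, B t)) * A t
      - ((1 - η) ^ 2 * (∫ t, A t) * (∫ t, B t)) * D t) ≤ (∫ t, D t) ^ 2 * C t := by
    intro t
    refine le_of_mul_le_mul_right ?_ (hDpos t)
    have h1 := mul_nonneg (sub_nonneg.2 (hA' t)) (sub_nonneg.2 (hB' t))
    have h2 := mul_le_mul_of_nonneg_left (hABCD t) (sq_nonneg (∫ t, D t))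
    have h3 := mul_nonneg (sub_nonneg.2 hη) h1
    nlinarith [h2, h3]
  have hint := integral_mono
    ((((hB.const_mul ((1 - η) * (∫ t, D t) * (∫ t, A t))).add
      (hA.const_mul ((1 - η) * (∫ t, D t) * (∫ t, B t)))).sub
      (hD.const_mul ((1 - η) ^ 2 * (∫ t, A t) * (∫ t, B t)))).const_mul (1 - η))
    (hC.const_mul ((∫ t, D t) ^ 2)) key
  have hBA : Integrable (fun t => ((1 - η) * (∫ t, D t) * (∫ t, A t)) * B t +
      ((1 - η) * (∫ t, D t) * (∫ t, B t)) * A t) volume :=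
    (hB.const_mul _).add (hA.const_mul _)
  simp only [integral_const_mul, Pi.sub_apply, Pi.add_apply] at hint
  rw [integral_sub hBA (hD.const_mul _), integral_add (hB.const_mul _) (hA.const_mul _)] at hint
  simp only [integral_const_mul] at hint
  refine le_of_mul_le_mul_right ?_ hZ
  linarith

end WeakCoupling

/-! ### Weakly coupled densities and integration of one coordinate at a time -/

lemma measurable_cons {X : Type*} [MeasurableSpace X] {n : ℕ} :
    Measurable fun p : X × (Fin n → X) => (Fin.cons p.1 p.2 : Fin (n + 1) → X) := by
  refine measurable_pi_iff.2 fun i => ?_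
  refine Fin.cases ?_ (fun i => ?_) i
  · exact measurable_fst
  · exact (measurable_pi_apply i).comp measurable_snd

lemma integral_pi_fin_succ {X : Type*} [MeasureSpace X] [SigmaFinite (volume : Measure X)] {n : ℕ}
    {F : (Fin (n + 1) → X) → ℝ} (hF : Integrable F volume) :
    ∫ x, F x = ∫ x : Fin n → X, ∫ t, F (Fin.cons t x) := by
  have hmp := (volume_preserving_piFinSuccAbove (fun _ : Fin (n + 1) => X) 0).symm
  have hcons : ∀ p : X × (Fin n → X),
      (MeasurableEquiv.piFinSuccAbove (fun _ : Fin (n + 1) => X) 0).symm p =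
        (Fin.cons p.1 p.2 : Fin (n + 1) → X) := fun p => by
    simp [MeasurableEquiv.piFinSuccAbove, Fin.insertNthEquiv]
  rw [← hmp.integral_comp' F]
  simp only [hcons]
  have hint : Integrable (fun p : X × (Fin n → X) => F (Fin.cons p.1 p.2))
      (volume.prod volume) := by
    have := (hmp.integrable_comp_emb (MeasurableEquiv.measurableEmbedding _)).2 hF
    simp only [Function.comp_def, hcons] at this
    exact this
  exact integral_prod_symm _ hint

section WeakCoupling

variable {X : Type*} [MeasureSpace X] {n : ℕ}

/-- A positive bounded density `ρ` on `X ^ n` is `η`-weakly coupled if all cross ratios of `ρ` with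
respect to two different coordinates are at least `1 - η`. Product densities have cross ratios
equal to one. -/
structure IsWeaklyCoupled (η : ℝ) (ρ : (Fin n → X) → ℝ) : Prop where
  measurable : Measurable ρ
  pos : ∀ x, 0 < ρ x
  bdd : ∃ M, ∀ x, ρ x ≤ M
  cross : ∀ i j, i ≠ j → ∀ x s s' t t',
    (1 - η) * (ρ (Function.update (Function.update x i s) j t) *
        ρ (Function.update (Function.update x i s') j t')) ≤
      ρ (Function.update (Function.update x i s') j t) *
        ρ (Function.update (Function.update x i s) j t')

/-- The density of the last `n` coordinates. -/
noncomputable def marginal (ρ : (Fin (n + 1) → X) → ℝ) (x : Fin n → X) : ℝ :=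
  ∫ t, ρ (Fin.cons t x)

/-- The conditional expectation of `g` given the last `n` coordinates, under the density `ρ`. -/
noncomputable def condMean (ρ g : (Fin (n + 1) → X) → ℝ) (x : Fin n → X) : ℝ :=
  (∫ t, g (Fin.cons t x) * ρ (Fin.cons t x)) / marginal ρ x

namespace IsWeaklyCoupled

/-- The cross-ratio bound for the integrated coordinate and another one. -/
lemma cross_cons {η : ℝ} {ρ : (Fin (n + 1) → X) → ℝ} (h : IsWeaklyCoupled η ρ) (j : Fin n)
    (x : Fin n → X) (t t' u u' : X) :
    (1 - η) * (ρ (Fin.cons t (Function.update x j u)) * ρ (Fin.cons t' (Function.update x j u'))) ≤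
      ρ (Fin.cons t' (Function.update x j u)) * ρ (Fin.cons t (Function.update x j u')) := by
  have := h.cross 0 j.succ (Fin.succ_ne_zero j).symm (Fin.cons t x) t t' u u'
  simpa only [Fin.update_cons_zero, ← Fin.cons_update] using this

variable [IsProbabilityMeasure (volume : Measure X)]

attribute [local instance] isProbabilityMeasure_volume_pi

lemma integrable {η : ℝ} {ρ : (Fin n → X) → ℝ} (h : IsWeaklyCoupled η ρ) :
    Integrable ρ volume := by
  obtain ⟨M, hM⟩ := h.bdd
  exact integrable_of_measurable_of_abs_le h.measurable fun x => by
    rw [abs_of_pos (h.pos x)]; exact hM x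

lemma integrable_fiber {η : ℝ} {ρ : (Fin (n + 1) → X) → ℝ} (h : IsWeaklyCoupled η ρ)
    (x : Fin n → X) : Integrable (fun t => ρ (Fin.cons t x)) volume := by
  obtain ⟨M, hM⟩ := h.bdd
  exact integrable_of_measurable_of_abs_le
    (h.measurable.comp (measurable_cons.comp measurable_prodMk_right)) fun t => by
      rw [abs_of_pos (h.pos _)]; exact hM _

lemma marginal_pos {η : ℝ} {ρ : (Fin (n + 1) → X) → ℝ} (h : IsWeaklyCoupled η ρ)
    (x : Fin n → X) : 0 < marginal ρ x :=
  integral_pos_of_forall_pos (h.integrable_fiber x) fun _ => h.pos _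

lemma marginal {η η' : ℝ} {ρ : (Fin (n + 1) → X) → ℝ} (h : IsWeaklyCoupled η ρ) (hη : η ≤ 1)
    (hη' : 1 - η' ≤ (1 - η) * (1 - η ^ 2)) : IsWeaklyCoupled η' (marginal ρ) where
  measurable := by
    have : StronglyMeasurable fun p : (Fin n → X) × X => ρ (Fin.cons p.2 p.1) :=
      (h.measurable.comp (measurable_cons.comp measurable_swap)).stronglyMeasurable
    exact this.integral_prod_right.measurable
  pos := h.marginal_pos
  bdd := by
    obtain ⟨M, hM⟩ := h.bdd
    refine ⟨M, fun x => ?_⟩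
    simpa [_root_.marginal] using
      integral_mono (h.integrable_fiber x) (integrable_const M) fun t => hM _
  cross i j hij x s s' t t' := by
    have key := integral_cross_ratio
      (h.integrable_fiber (Function.update (Function.update x i s) j t))
      (h.integrable_fiber (Function.update (Function.update x i s') j t'))
      (h.integrable_fiber (Function.update (Function.update x i s') j t))
      (h.integrable_fiber (Function.update (Function.update x i s) j t'))
      (fun _ => h.pos _) hη
      (fun r => by
        have := h.cross i.succ j.succ (fun e => hij (Fin.succ_injective _ e))
          (Fin.cons r x) s s' t t'
        simpa only [← Fin.cons_update] using this)
      (fun r r' => h.cross_cons j (Function.update x i s) r r' t t')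
      (fun r r' => by
        rw [Function.update_comm hij, Function.update_comm hij]
        exact h.cross_cons i (Function.update x j t') r r' s' s)
    refine le_trans (mul_le_mul_of_nonneg_right hη' ?_) key
    exact mul_nonneg (h.marginal_pos _).le (h.marginal_pos _).le

lemma hasCoordOscLE_condMean {η c : ℝ} {ρ g : (Fin (n + 1) → X) → ℝ} (h : IsWeaklyCoupled η ρ)
    (hη : 0 ≤ η) (hg : Measurable g) (hosc : HasCoordOscLE c g) :
    HasCoordOscLE (c * (1 + η)) (condMean ρ g) := by
  intro i x s s'
  have : Nonempty X := nonempty_of_isProbabilityMeasure (volume : Measure X)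
  obtain ⟨B, hB⟩ := hosc.exists_abs_le
  have hfib : ∀ y : Fin n → X, Measurable fun t => g (Fin.cons t y) := fun y =>
    hg.comp (measurable_cons.comp measurable_prodMk_right)
  refine mean_le_mean_add_of_ratio (h.integrable_fiber _) (h.integrable_fiber _)
    (fun _ => h.pos _) (fun _ => h.pos _) (hfib _) (hfib _) (fun _ => hB _) (fun _ => hB _)
    (fun t => ?_) (fun t t' => ?_) hη (fun t t' => ?_)
  · have := hosc i.succ (Fin.cons t x) s s'
    simpa only [← Fin.cons_update] using this
  · have := hosc 0 (Fin.cons t (Function.update x i s')) t t'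
    simpa only [Fin.update_cons_zero] using this
  · have := h.cross_cons i x t' t s s'
    exact this

/-- The induction that integrates out the coordinates one by one. With `n` coordinates left the
density is `1 / (R + n)`-weakly coupled; the next marginal is `1 / (R + n - 1)`-weakly coupled
because `1 / M + 1 / M ^ 2 ≤ 1 / (M - 1)`, and the conditional mean has its oscillations multiplied
by `1 + 1 / (R + n)`. The exponent is a closed form for the sum of the squared oscillations which
occur in Hoeffding's lemma. -/
theorem integral_exp_mul_le {R : ℝ} (hR : 0 < R) (n : ℕ) :
    ∀ {ρ g : (Fin n → X) → ℝ} {c : ℝ}, IsWeaklyCoupled (1 / (R + n)) ρ → Measurable g →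
      HasCoordOscLE c g →
      ∫ x, Real.exp (g x) * ρ x ≤ (∫ x, ρ x) *
        Real.exp ((∫ x, g x * ρ x) / (∫ x, ρ x) +
          c ^ 2 * ((R + n + 1) * n / (R + 1)) / 8) := by
  induction n with
  | zero =>
    intro ρ g c h _ _
    have hρ := (h.pos default).ne'
    simp only [integral_unique, probReal_univ, one_smul, CharP.cast_eq_zero, mul_zero, zero_div,
      add_zero]
    rw [mul_div_assoc, div_self hρ, mul_one, mul_comm]
  | succ n ih =>
    intro ρ g c h hg hosc
    have : Nonempty X := nonempty_of_isProbabilityMeasure (volume : Measure X)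
    obtain ⟨B, hB⟩ := hosc.exists_abs_le
    have hM : 0 < R + n + 1 := by positivity
    have hcast : R + ((n + 1 : ℕ) : ℝ) = R + n + 1 := by push_cast; ring
    rw [hcast] at h ⊢
    have hη0 : 0 ≤ 1 / (R + n + 1) := by positivity
    have hη1 : 1 / (R + n + 1) ≤ 1 := by
      rw [div_le_one hM]
      have : (0 : ℝ) ≤ n := n.cast_nonneg
      linarith
    have hfib : ∀ y : Fin n → X, Measurable fun t => g (Fin.cons t y) := fun y =>
      hg.comp (measurable_cons.comp measurable_prodMk_right)
    have hintg : Integrable (fun x => g x * ρ x) volume :=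
      h.integrable.bdd_mul hg.aestronglyMeasurable (Filter.Eventually.of_forall hB)
    have hinte : Integrable (fun x => Real.exp (g x) * ρ x) volume :=
      h.integrable.bdd_mul (c := Real.exp B) hg.exp.aestronglyMeasurable
        (Filter.Eventually.of_forall fun x => by
          rw [Real.norm_eq_abs, Real.abs_exp]
          exact Real.exp_le_exp.2 ((le_abs_self _).trans (hB x)))
    have hosc' : HasCoordOscLE (c * (1 + 1 / (R + n + 1))) (condMean ρ g) :=
      h.hasCoordOscLE_condMean hη0 hg hosc
    have hmeas' : Measurable (condMean ρ g) := by
      have : StronglyMeasurable fun p : (Fin n → X) × X =>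
          g (Fin.cons p.2 p.1) * ρ (Fin.cons p.2 p.1) :=
        ((hg.mul h.measurable).comp (measurable_cons.comp measurable_swap)).stronglyMeasurable
      exact this.integral_prod_right.measurable.div
        (h.marginal hη1 (η' := 1 - (1 - 1 / (R + n + 1)) * (1 - (1 / (R + n + 1)) ^ 2))
          (by simp)).measurable
    have hZ : ∫ x, ρ x = ∫ x, _root_.marginal ρ x := integral_pi_fin_succ h.integrable
    have hmean : ∫ x, g x * ρ x = ∫ x, condMean ρ g x * _root_.marginal ρ x := by
      rw [integral_pi_fin_succ hintg]
      congr 1; ext x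
      rw [condMean, div_mul_cancel₀ _ (h.marginal_pos x).ne']
    have hstep : ∀ x : Fin n → X, ∫ t, Real.exp (g (Fin.cons t x)) * ρ (Fin.cons t x) ≤
        Real.exp (c ^ 2 / 8) * (Real.exp (condMean ρ g x) * _root_.marginal ρ x) := by
      intro x
      refine (integral_exp_mul_le_of_osc (h.integrable_fiber x) (fun _ => h.pos _) (hfib x)
        (c := c) fun t t' => ?_).trans_eq ?_
      · have := hosc 0 (Fin.cons t x) t t'
        simpa only [Fin.update_cons_zero] using this
      · rw [Real.exp_add, condMean, _root_.marginal]
        ring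
    rw [integral_pi_fin_succ hinte]
    have hρ' : IsWeaklyCoupled (1 / (R + n)) (_root_.marginal ρ) := by
      refine h.marginal hη1 ?_
      have hRn : 0 < R + n := by positivity
      have : (1 - 1 / (R + n + 1)) * (1 - (1 / (R + n + 1)) ^ 2) - (1 - 1 / (R + n)) =
          (2 * (R + n) + 1) / ((R + n) * (R + n + 1) ^ 3) := by
        field_simp
        ring
      have hpos : 0 ≤ (2 * (R + n) + 1) / ((R + n) * (R + n + 1) ^ 3) := by positivity
      linarith
    have hZpos : 0 < ∫ x, _root_.marginal ρ x := integral_pos_of_forall_pos hρ'.integrable hρ'.pos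
    obtain ⟨B', hB'⟩ := hosc'.exists_abs_le
    have hinte' : Integrable (fun x => Real.exp (condMean ρ g x) * _root_.marginal ρ x) volume :=
      hρ'.integrable.bdd_mul (c := Real.exp B') hmeas'.exp.aestronglyMeasurable
        (Filter.Eventually.of_forall fun x => by
          rw [Real.norm_eq_abs, Real.abs_exp]
          exact Real.exp_le_exp.2 ((le_abs_self _).trans (hB' x)))
    refine (integral_mono_of_nonneg (Filter.Eventually.of_forall fun x =>
      integral_nonneg fun t => mul_nonneg (Real.exp_pos _).le (h.pos _).le)
      (hinte'.const_mul (Real.exp (c ^ 2 / 8))) (Filter.Eventually.of_forall hstep)).trans ?_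
    rw [integral_const_mul]
    refine (mul_le_mul_of_nonneg_left (ih hρ' hmeas' hosc') (Real.exp_pos _).le).trans ?_
    rw [hZ, hmean, mul_left_comm, ← Real.exp_add]
    refine mul_le_mul_of_nonneg_left (Real.exp_le_exp.2 ?_) hZpos.le
    have hsum : (R + n + 1 + 1) * ((n + 1 : ℕ) : ℝ) / (R + 1) -
        (1 + (1 + 1 / (R + n + 1)) ^ 2 * ((R + n + 1) * n / (R + 1))) = 1 / (R + n + 1) := by
      push_cast
      field_simp
      ring
    have hgap : 0 ≤ c ^ 2 * (1 / (R + n + 1)) := by positivity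
    rw [← hsum] at hgap
    linarith

end IsWeaklyCoupled

end WeakCoupling

/-! ### The cone of log-Lipschitz functions and its Hilbert metric -/

lemma periodic_comp_coe (f : UnitAddCircle → ℝ) :
    Function.Periodic (fun t : ℝ => f (t : UnitAddCircle)) 1 := fun t => by
  simp only [AddCircle.coe_add_period]

lemma periodic_deriv {f : ℝ → ℝ} {T : ℝ} (hf : Function.Periodic f T) :
    Function.Periodic (deriv f) T := fun x => by
  have h := deriv_comp_add_const f T x
  rw [← h]
  congr 1
  ext y
  exact hf y

/-- On the cone, `|ψ'| < a ψ`. -/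
lemma abs_deriv_lt_of_mem_logLipCone {a : ℝ} {ψ : UnitAddCircle → ℝ} (h : ψ ∈ logLipCone a)
    (t : ℝ) : |deriv (fun s : ℝ => ψ (s : UnitAddCircle)) t| < a * ψ t := by
  obtain ⟨h2, hpos, hlog⟩ := h
  have := hlog t
  rwa [deriv.log (h2.differentiable (by norm_num) t) (hpos _).ne', abs_div, abs_of_pos (hpos _),
    div_lt_iff₀ (hpos _)] at this

/-- For `v` and `w` in the cone of parameter `a ≤ b`, a large multiple of `w` dominates `v` in the
cone of parameter `b`, also when `a = b`. Thus `coneBeta` is the infimum of a nonempty set. -/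
lemma exists_smul_sub_mem_logLipCone {a b : ℝ} (ha : 0 < a) (hab : a ≤ b)
    {v w : UnitAddCircle → ℝ} (hv : v ∈ logLipCone a) (hw : w ∈ logLipCone a) :
    ∃ t : ℝ, 0 < t ∧ t • w - v ∈ logLipCone b := by
  have hv2 := hv.1
  have hw2 := hw.1
  have hb : 0 < b := ha.trans_le hab
  have hdv := hv2.continuous_deriv (by norm_num)
  have hdw := hw2.continuous_deriv (by norm_num)
  -- By compactness, `b w - |w'|` has a positive minimum `κ`.
  obtain ⟨κ, hκ, hκw⟩ : ∃ κ > 0, ∀ t : ℝ,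
      κ ≤ b * w t - |deriv (fun s : ℝ => w (s : UnitAddCircle)) t| := by
    have hper : Function.Periodic (fun t : ℝ =>
        b * w t - |deriv (fun s : ℝ => w (s : UnitAddCircle)) t|) 1 := fun t => by
      have h1 := periodic_comp_coe w t
      have h2 := periodic_deriv (periodic_comp_coe w) t
      simp only at h1 h2 ⊢
      rw [h1, h2]
    have hcont : Continuous (fun t : ℝ =>
        b * w t - |deriv (fun s : ℝ => w (s : UnitAddCircle)) t|) :=
      (hw2.continuous.const_mul b).sub hdw.abs
    obtain ⟨_, ⟨t₀, rfl⟩, hmin⟩ :=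
      (hper.compact_of_continuous one_ne_zero hcont).exists_isLeast (Set.range_nonempty _)
    refine ⟨_, ?_, fun t => hmin ⟨t, rfl⟩⟩
    have := abs_deriv_lt_of_mem_logLipCone hw t₀
    have := mul_le_mul_of_nonneg_right hab (hw.2.1 (t₀ : UnitAddCircle)).le
    simp only
    linarith
  obtain ⟨B, hB⟩ : ∃ B, ∀ t : ℝ, b * v t + |deriv (fun s : ℝ => v (s : UnitAddCircle)) t| ≤ B := by
    have hper : Function.Periodic (fun t : ℝ =>
        b * v t + |deriv (fun s : ℝ => v (s : UnitAddCircle)) t|) 1 := fun t => by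
      have h1 := periodic_comp_coe v t
      have h2 := periodic_deriv (periodic_comp_coe v) t
      simp only at h1 h2 ⊢
      rw [h1, h2]
    have hcont : Continuous (fun t : ℝ =>
        b * v t + |deriv (fun s : ℝ => v (s : UnitAddCircle)) t|) :=
      (hv2.continuous.const_mul b).add hdv.abs
    obtain ⟨_, ⟨t₀, rfl⟩, hmax⟩ :=
      (hper.compact_of_continuous one_ne_zero hcont).exists_isGreatest (Set.range_nonempty _)
    exact ⟨_, fun t => hmax ⟨t, rfl⟩⟩
  have hBpos : 0 < B := lt_of_lt_of_le (by have := hv.2.1 ((0 : ℝ) : UnitAddCircle); positivity)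
    (hB 0)
  set r := (B + 1) / κ with hr
  have hrpos : 0 < r := by positivity
  have hderiv : ∀ t : ℝ, deriv (fun s : ℝ => (r • w - v) (s : UnitAddCircle)) t =
      r * deriv (fun s : ℝ => w (s : UnitAddCircle)) t -
        deriv (fun s : ℝ => v (s : UnitAddCircle)) t := fun t => by
    have h1 := (hw2.differentiable (by norm_num) t).hasDerivAt.const_mul r
    have h2 := (hv2.differentiable (by norm_num) t).hasDerivAt
    exact (h1.sub h2).deriv
  have hlt : ∀ t : ℝ, |deriv (fun s : ℝ => (r • w - v) (s : UnitAddCircle)) t| <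
      b * (r • w - v) t := fun t => by
    rw [hderiv]
    have h1 := mul_le_mul_of_nonneg_left (hκw t) hrpos.le
    have h2 : r * κ = B + 1 := by rw [hr]; field_simp
    have h3 := abs_sub (r * deriv (fun s : ℝ => w (s : UnitAddCircle)) t)
      (deriv (fun s : ℝ => v (s : UnitAddCircle)) t)
    rw [abs_mul, abs_of_pos hrpos] at h3
    have h4 := hB t
    simp only [Pi.sub_apply, Pi.smul_apply, smul_eq_mul]
    linarith
  have hpos : ∀ x, 0 < (r • w - v) x := fun x => by
    obtain ⟨t, rfl⟩ := QuotientAddGroup.mk_surjective x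
    exact pos_of_mul_pos_right ((abs_nonneg _).trans_lt (hlt t)) hb.le
  have hC2 : ContDiff ℝ 2 (fun s : ℝ => (r • w - v) (s : UnitAddCircle)) :=
    (contDiff_const.mul hw2).sub hv2
  refine ⟨r, hrpos, hC2, hpos, fun t => ?_⟩
  rw [deriv.log (hC2.differentiable (by norm_num) t) (hpos _).ne', abs_div, abs_of_pos (hpos _),
    div_lt_iff₀ (hpos _)]
  exact hlt t

lemma le_coneBeta_mul {a b : ℝ} (ha : 0 < a) (hab : a ≤ b) {v w : UnitAddCircle → ℝ}
    (hv : v ∈ logLipCone a) (hw : w ∈ logLipCone a) (s : UnitAddCircle) :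
    v s ≤ coneBeta (logLipCone b) v w * w s := by
  rw [← div_le_iff₀ (hw.2.1 s)]
  refine le_csInf (exists_smul_sub_mem_logLipCone ha hab hv hw) ?_
  rintro t ⟨-, ht⟩
  rw [div_le_iff₀ (hw.2.1 s)]
  have := ht.2.1 s
  simp only [Pi.sub_apply, Pi.smul_apply, smul_eq_mul] at this
  linarith

/-- The Hilbert metric of the cone dominates the oscillation of `log (v / w)`. -/
lemma mul_le_exp_hilbertMetric_mul {a b : ℝ} (ha : 0 < a) (hab : a ≤ b) {v w : UnitAddCircle → ℝ}
    (hv : v ∈ logLipCone a) (hw : w ∈ logLipCone a) (s s' : UnitAddCircle) :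
    v s * w s' ≤ Real.exp (hilbertMetric (logLipCone b) v w) * (w s * v s') := by
  have h1 := le_coneBeta_mul ha hab hv hw s
  have h2 := le_coneBeta_mul ha hab hw hv s'
  have hβ : 0 < coneBeta (logLipCone b) v w :=
    pos_of_mul_pos_left ((hv.2.1 s).trans_le h1) (hw.2.1 s).le
  have hβ' : 0 < coneBeta (logLipCone b) w v :=
    pos_of_mul_pos_left ((hw.2.1 s').trans_le h2) (hv.2.1 s').le
  rw [hilbertMetric, Real.exp_add, Real.exp_log hβ, Real.exp_log hβ']
  have := mul_le_mul h1 h2 (hw.2.1 s').le ((hv.2.1 s).le.trans h1)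
  linarith

/-- Harnack inequality on the cone. -/
lemma le_exp_mul_of_mem_logLipCone {a : ℝ} {ψ : UnitAddCircle → ℝ} (h : ψ ∈ logLipCone a)
    (s s' : UnitAddCircle) : ψ s ≤ Real.exp a * ψ s' := by
  obtain ⟨x, hx, rfl⟩ : ∃ x ∈ Set.Ico (0 : ℝ) (0 + 1), (x : UnitAddCircle) = s := by
    have := AddCircle.coe_image_Ico_eq (p := (1 : ℝ)) 0
    have hs : s ∈ (Set.univ : Set UnitAddCircle) := Set.mem_univ s
    rwa [← this] at hs
  obtain ⟨y, hy, rfl⟩ : ∃ y ∈ Set.Ico (0 : ℝ) (0 + 1), (y : UnitAddCircle) = s' := by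
    have := AddCircle.coe_image_Ico_eq (p := (1 : ℝ)) 0
    have hs : s' ∈ (Set.univ : Set UnitAddCircle) := Set.mem_univ s'
    rwa [← this] at hs
  obtain ⟨h2, hpos, hlog⟩ := h
  have hmv := Convex.norm_image_sub_le_of_norm_deriv_le (𝕜 := ℝ) (s := Set.univ) (C := a)
    (f := fun s : ℝ => Real.log (ψ (s : UnitAddCircle))) (x := y) (y := x)
    (fun t _ => (h2.differentiable (by norm_num) t).log (hpos _).ne')
    (fun t _ => (hlog t).le) convex_univ trivial trivial
  have ha : 0 ≤ a := (abs_nonneg _).trans (hlog 0).le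
  have hxy : ‖x - y‖ ≤ 1 := by
    rw [Real.norm_eq_abs, abs_le]
    constructor <;> linarith [hx.1, hx.2, hy.1, hy.2]
  have := (le_abs_self _).trans (hmv.trans (mul_le_of_le_one_right ha hxy))
  rw [← Real.exp_log (hpos x), ← Real.exp_log (hpos y), ← Real.exp_add, Real.exp_le_exp]
  linarith

/-! ### Regularization on the torus -/

lemma isProbabilityMeasure_volume_unitAddCircle :
    IsProbabilityMeasure (volume : Measure UnitAddCircle) :=
  ⟨UnitAddCircle.measure_univ⟩

section Regularization

open Filter Topology Metric

attribute [local instance] isProbabilityMeasure_volume_pi isProbabilityMeasure_volume_unitAddCircle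

lemma isUnifLocDoublingMeasure_torus (N : ℕ) :
    IsUnifLocDoublingMeasure (volume : Measure (Torus N)) := by
  refine ⟨⟨2 ^ N, ?_⟩⟩
  filter_upwards [self_mem_nhdsWithin] with ε hε x
  have hε : 0 < ε := hε
  rw [volume_pi_closedBall _ (by positivity), volume_pi_closedBall _ hε.le]
  simp only [AddCircle.volume_closedBall, Finset.prod_const, Finset.card_univ, Fintype.card_fin]
  push_cast
  rw [← mul_pow]
  refine pow_le_pow_left' ?_ N
  rw [← ENNReal.ofReal_ofNat 2, ← ENNReal.ofReal_mul (by norm_num)]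
  refine ENNReal.ofReal_le_ofReal ?_
  rw [mul_min_of_nonneg _ _ (by norm_num)]
  exact min_le_min (by norm_num) (by linarith)

/-- The average of `g` over the closed ball of radius `r` about `x`, written as an average of
translates. -/
noncomputable def ballAverage {N : ℕ} (g : Torus N → ℝ) (r : ℝ) (x : Torus N) : ℝ :=
  ⨍ y in closedBall (0 : Torus N) r, g (x + y)

variable {N : ℕ} {g : Torus N → ℝ} {c : ℝ}

lemma isProbabilityMeasure_cond_closedBall {r : ℝ} (hr : 0 < r) :
    IsProbabilityMeasure
      (((volume.restrict (closedBall (0 : Torus N) r)) Set.univ)⁻¹ •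
        volume.restrict (closedBall (0 : Torus N) r)) := by
  have h0 : (volume.restrict (closedBall (0 : Torus N) r)) ≠ 0 := by
    rw [Ne, Measure.restrict_eq_zero]
    exact (measure_closedBall_pos _ _ hr).ne'
  have : NeZero (volume.restrict (closedBall (0 : Torus N) r)) := ⟨h0⟩
  infer_instance

lemma ballAverage_eq (g : Torus N → ℝ) (r : ℝ) (x : Torus N) :
    ballAverage g r x = ⨍ y in closedBall x r, g y := by
  have hmp := measurePreserving_add_left (volume : Measure (Torus N)) x
  have hpre : (fun y => x + y) ⁻¹' closedBall x r = closedBall 0 r := by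
    ext y; simp
  rw [ballAverage, setAverage_eq, setAverage_eq, ← hpre,
    hmp.setIntegral_preimage_emb (measurableEmbedding_addLeft x) g]
  simp only [measureReal_def]
  rw [hmp.measure_preimage measurableSet_closedBall.nullMeasurableSet]

lemma measurable_ballAverage (hg : Integrable g volume) (r : ℝ) :
    Measurable (ballAverage g r) := by
  obtain ⟨g₀, hg₀, hae⟩ := hg.aestronglyMeasurable
  have heq : ballAverage g r = ballAverage g₀ r := by
    ext x
    rw [ballAverage_eq, ballAverage_eq]
    exact setAverage_congr_fun measurableSet_closedBall (hae.mono fun y hy _ => hy)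
  rw [heq]
  have : StronglyMeasurable fun p : Torus N × Torus N => g₀ (p.1 + p.2) :=
    (hg₀.measurable.comp (measurable_fst.add measurable_snd)).stronglyMeasurable
  exact this.integral_prod_right.measurable

lemma integrable_translate (hg : Integrable g volume) (r : ℝ) (x : Torus N) :
    Integrable (fun y => g (x + y)) (((volume.restrict (closedBall (0 : Torus N) r)) Set.univ)⁻¹ •
      volume.restrict (closedBall (0 : Torus N) r)) :=
  (hg.comp_add_left x).integrableOn.to_average

/-- Averaging over translates does not increase the coordinate oscillations. -/
lemma HasCoordOscLE.ballAverage (hg : Integrable g volume) (hosc : HasCoordOscLE c g) {r : ℝ}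
    (hr : 0 < r) : HasCoordOscLE c (ballAverage g r) := by
  intro i x s s'
  have := isProbabilityMeasure_cond_closedBall (N := N) hr
  have hmono := integral_mono (integrable_translate hg r (Function.update x i s))
    ((integrable_translate hg r (Function.update x i s')).add (integrable_const c)) fun y => by
      have h := hosc i (x + y) (s + y i) (s' + y i)
      have hu : ∀ u, Function.update x i u + y = Function.update (x + y) i (u + y i) := fun u => by
        ext j
        by_cases hj : j = i
        · subst hj; simp
        · simp [hj]
      simpa only [Pi.add_apply, hu] using h
  rw [integral_add' (integrable_translate hg r _) (integrable_const c), integral_const, probReal_univ,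
    one_smul] at hmono
  exact hmono

lemma abs_ballAverage_le {B : ℝ} (hB : ∀ x, |g x| ≤ B) {r : ℝ} (hr : 0 < r) (x : Torus N) :
    |ballAverage g r x| ≤ B := by
  have := isProbabilityMeasure_cond_closedBall (N := N) hr
  have h := norm_integral_le_of_norm_le_const (μ := (((volume.restrict
    (closedBall (0 : Torus N) r)) Set.univ)⁻¹ • volume.restrict (closedBall (0 : Torus N) r)))
    (f := fun y => g (x + y)) (Eventually.of_forall fun y => hB (x + y))
  rwa [probReal_univ, mul_one] at h

/-- An integrable function of bounded coordinate oscillation is an almost everywhere limit of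
Borel functions with the same bounds on the oscillations. -/
lemma exists_measurable_approx (hg : Integrable g volume) (hosc : HasCoordOscLE c g) {B : ℝ}
    (hB : ∀ x, |g x| ≤ B) :
    ∃ G : ℕ → Torus N → ℝ, (∀ k, Measurable (G k)) ∧ (∀ k, HasCoordOscLE c (G k)) ∧
      (∀ k x, |G k x| ≤ B) ∧ ∀ᵐ x, Tendsto (fun k => G k x) atTop (𝓝 (g x)) := by
  have := isUnifLocDoublingMeasure_torus N
  have hpos : ∀ k : ℕ, 0 < 1 / ((k : ℝ) + 1) := fun k => Nat.one_div_pos_of_nat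
  refine ⟨fun k => ballAverage g (1 / ((k : ℝ) + 1)), fun k => measurable_ballAverage hg _,
    fun k => hosc.ballAverage hg (hpos k), fun k => abs_ballAverage_le hB (hpos k), ?_⟩
  filter_upwards [IsUnifLocDoublingMeasure.ae_tendsto_average (volume : Measure (Torus N))
    hg.locallyIntegrable 1] with x hx
  have := hx (fun _ : ℕ => x) (fun k => 1 / ((k : ℝ) + 1))
    (tendsto_nhdsWithin_iff.2 ⟨tendsto_one_div_add_atTop_nhds_zero_nat, Eventually.of_forall hpos⟩)
    (Eventually.of_forall fun k => mem_closedBall_self (by have := hpos k; positivity))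
  simpa only [ballAverage_eq] using this

/-- The exponential moment bound for functions that need not be Borel measurable. -/
theorem IsWeaklyCoupled.integral_exp_mul_le_of_integrable {R : ℝ} (hR : 0 < R) {ρ : Torus N → ℝ}
    (h : IsWeaklyCoupled (1 / (R + N)) ρ) (hg : Integrable g volume) (hosc : HasCoordOscLE c g) :
    ∫ x, Real.exp (g x) * ρ x ≤ (∫ x, ρ x) *
      Real.exp ((∫ x, g x * ρ x) / (∫ x, ρ x) + c ^ 2 * ((R + N + 1) * N / (R + 1)) / 8) := by
  obtain ⟨B, hB⟩ := hosc.exists_abs_le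
  obtain ⟨G, hGm, hGosc, hGB, hlim⟩ := exists_measurable_approx hg hosc hB
  have h1 : Tendsto (fun k => ∫ x, Real.exp (G k x) * ρ x) atTop
      (𝓝 (∫ x, Real.exp (g x) * ρ x)) := by
    refine tendsto_integral_of_dominated_convergence (fun x => Real.exp B * ρ x)
      (fun k => ((hGm k).exp.mul h.measurable).aestronglyMeasurable) (h.integrable.const_mul _)
      (fun k => Eventually.of_forall fun x => ?_) ?_
    · rw [norm_mul, Real.norm_eq_abs, Real.norm_eq_abs, Real.abs_exp, abs_of_pos (h.pos x)]
      exact mul_le_mul_of_nonneg_right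
        (Real.exp_le_exp.2 ((le_abs_self _).trans (hGB k x))) (h.pos x).le
    · filter_upwards [hlim] with x hx
      exact ((Real.continuous_exp.tendsto _).comp hx).mul_const _
  have h2 : Tendsto (fun k => ∫ x, G k x * ρ x) atTop (𝓝 (∫ x, g x * ρ x)) := by
    refine tendsto_integral_of_dominated_convergence (fun x => B * ρ x)
      (fun k => ((hGm k).mul h.measurable).aestronglyMeasurable) (h.integrable.const_mul _)
      (fun k => Eventually.of_forall fun x => ?_) ?_
    · rw [norm_mul, Real.norm_eq_abs, Real.norm_eq_abs, abs_of_pos (h.pos x)]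
      exact mul_le_mul_of_nonneg_right (hGB k x) (h.pos x).le
    · filter_upwards [hlim] with x hx
      exact hx.mul_const _
  refine le_of_tendsto_of_tendsto' h1 (((Real.continuous_exp.tendsto _).comp
    ((h2.div_const _).add_const _)).const_mul _) fun k => ?_
  exact IsWeaklyCoupled.integral_exp_mul_le hR N h (hGm k) (hGosc k)

end Regularization

/-! ### Concentration for quasi-product measures -/

section Concentration

attribute [local instance] isProbabilityMeasure_volume_pi isProbabilityMeasure_volume_unitAddCircle

lemma hasCoordOscLE_of_mem_smallOsc {N : ℕ} {α : ℝ} (hα : 0 ≤ α) {g : Torus N → ℝ}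
    (hg : g ∈ smallOsc N α) : HasCoordOscLE α g := by
  intro i x s s'
  have h : ENNReal.ofReal |g (Function.update x i s) - g (Function.update x i s')| ≤
      coordOsc g i :=
    le_iSup_of_le x (le_iSup_of_le s (le_iSup_of_le s' le_rfl))
  have := (ENNReal.ofReal_le_ofReal_iff hα).1 (h.trans (hg.1 i))
  linarith [le_abs_self (g (Function.update x i s) - g (Function.update x i s'))]

/-- A fibre on which the conditional density is positive has positive total mass: otherwise the
normalizing integral, or its default value, would be zero. -/
lemma fiber_integral_pos {N : ℕ} {a : ℝ} {ρ : Torus N → ℝ} (hpos : ∀ x, 0 < ρ x) {i : Fin N}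
    {x : Torus N} (h : condDensity ρ i x ∈ logLipCone a) :
    0 < ∫ t : UnitAddCircle, ρ (Function.update x i t) := by
  have := h.2.1 0
  rw [condDensity] at this
  exact (div_pos_iff_of_pos_left (hpos _)).1 this

/-- The densities of quasi-product measures are weakly coupled. Two points of the circle are at
distance at most `1 / 2`, so the conditional densities have Hilbert distance at most `L / 2`. -/
lemma isWeaklyCoupled_of_isLipDisintegrated {N : ℕ} (hN : 2 ≤ N) {a b L : ℝ} (ha : 0 < a)
    (hab : a ≤ b) (hL : 0 ≤ L) {ρ : Torus N → ℝ} (hm : Measurable ρ) (hpos : ∀ x, 0 < ρ x)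
    (h : ∀ i j : Fin N, j ≠ i → IsLipDisintegrated a b L i j ρ) :
    IsWeaklyCoupled (L / 2) ρ where
  measurable := hm
  pos := hpos
  bdd := by
    have hcone : ∀ i x, condDensity ρ i x ∈ logLipCone a := fun i x => by
      have : Nontrivial (Fin N) := Fin.nontrivial_iff_two_le.2 hN
      obtain ⟨j, hj⟩ := exists_ne i
      exact (h i j hj).1 x
    have hosc : HasCoordOscLE a fun x => Real.log (ρ x) := fun i x s s' => by
      have h1 := le_exp_mul_of_mem_logLipCone (hcone i x) s s'
      have hZ := fiber_integral_pos hpos (hcone i x)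
      rw [condDensity, condDensity, ← mul_div_assoc, div_le_div_iff_of_pos_right hZ] at h1
      have h2 := Real.log_le_log (hpos _) h1
      rw [Real.log_mul (Real.exp_pos _).ne' (hpos _).ne', Real.log_exp] at h2
      linarith
    obtain ⟨B, hB⟩ := hosc.exists_abs_le
    refine ⟨Real.exp B, fun x => ?_⟩
    rw [← Real.exp_log (hpos x)]
    exact Real.exp_le_exp.2 ((le_abs_self _).trans (hB x))
  cross i j hij x s s' t t' := by
    have hl := h i j hij.symm
    set y := Function.update x j t
    set y' := Function.update x j t'
    have hθ : hilbertMetric (logLipCone b) (condDensity ρ i y) (condDensity ρ i y') ≤ L / 2 := by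
      refine (hl.2 y y' fun l _ hlj => ?_).trans ?_
      · simp only [y, y', Function.update_of_ne hlj]
      · have : dist (y j) (y' j) ≤ 1 / 2 := by
          rw [dist_eq_norm]
          simpa using AddCircle.norm_le_half_period (1 : ℝ) (x := y j - y' j) one_ne_zero
        have := mul_le_mul_of_nonneg_left this hL
        linarith
    have hmain := mul_le_exp_hilbertMetric_mul ha hab (hl.1 y) (hl.1 y') s s'
    have hZ := fiber_integral_pos hpos (hl.1 y)
    have hZ' := fiber_integral_pos hpos (hl.1 y')
    simp only [condDensity] at hmain
    rw [div_mul_div_comm, div_mul_div_comm, mul_comm (∫ _, ρ (Function.update y' i _)),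
      ← mul_div_assoc, div_le_div_iff_of_pos_right (mul_pos hZ hZ')] at hmain
    rw [Function.update_comm hij, Function.update_comm hij, Function.update_comm hij,
      Function.update_comm hij]
    have hprod : 0 < ρ (Function.update y' i s) * ρ (Function.update y i s') :=
      mul_pos (hpos _) (hpos _)
    have hexp : (1 - L / 2) * Real.exp (L / 2) ≤ 1 := by
      have h1 := Real.one_sub_le_exp_neg (L / 2)
      have h2 := mul_le_mul_of_nonneg_right h1 (Real.exp_pos (L / 2)).le
      rwa [← Real.exp_add, neg_add_cancel, Real.exp_zero] at h2
    have hle : ρ (Function.update y i s) * ρ (Function.update y' i s') ≤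
        Real.exp (L / 2) * (ρ (Function.update y' i s) * ρ (Function.update y i s')) :=
      hmain.trans (mul_le_mul_of_nonneg_right (Real.exp_le_exp.2 hθ) hprod.le)
    have hneg : 0 ≤ ρ (Function.update y i s) * ρ (Function.update y' i s') :=
      (mul_pos (hpos _) (hpos _)).le
    rcases le_total (1 - L / 2) 0 with h0 | h0
    · exact (mul_nonpos_of_nonpos_of_nonneg h0 hneg).trans
        (by rw [mul_comm (ρ (Function.update y i s'))]; exact hprod.le)
    · have h3 := mul_le_mul_of_nonneg_left hle h0
      have h4 := mul_le_mul_of_nonneg_right hexp hprod.le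
      linarith

lemma integral_withDensity_ofReal {N : ℕ} {ρ : Torus N → ℝ} (hm : Measurable ρ)
    (hpos : ∀ x, 0 < ρ x) (f : Torus N → ℝ) :
    ∫ x, f x ∂(volume.withDensity fun x => ENNReal.ofReal (ρ x)) = ∫ x, f x * ρ x := by
  rw [integral_withDensity_eq_integral_toReal_smul hm.ennreal_ofReal
    (Filter.Eventually.of_forall fun _ => ENNReal.ofReal_lt_top)]
  congr 1; ext x
  rw [ENNReal.toReal_ofReal (hpos x).le, smul_eq_mul, mul_comm]

/-- The upper deviation bound. The Chernoff parameter is `2 N ε`, which minimizes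
`-r ε + r ^ 2 / (4 N)`. -/
lemma measureReal_deviation_le {N : ℕ} (hN : 0 < N) {ρ : Torus N → ℝ} {g : Torus N → ℝ}
    {μ : Measure (Torus N)} [IsProbabilityMeasure μ]
    (hμ : μ = volume.withDensity fun x => ENNReal.ofReal (ρ x))
    (h : IsWeaklyCoupled (1 / ((N : ℝ) + N)) ρ) (hg : Integrable g volume)
    (hosc : HasCoordOscLE (N : ℝ)⁻¹ g) {ε : ℝ} (hε : 0 < ε) :
    μ.real {x | ε ≤ g x - ∫ y, g y ∂μ} ≤ Real.exp (-(ε ^ 2 * N)) := by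
  have hN' : (0 : ℝ) < N := by exact_mod_cast hN
  have hint : ∀ f : Torus N → ℝ, ∫ x, f x ∂μ = ∫ x, f x * ρ x := fun f => by
    rw [hμ, integral_withDensity_ofReal h.measurable h.pos]
  have hZ : ∫ x, ρ x = 1 := by
    have := hint fun _ => 1
    simpa using this.symm
  have hac : μ ≪ volume := hμ ▸ withDensity_absolutelyContinuous _ _
  have hgm : AEStronglyMeasurable g μ := hg.aestronglyMeasurable.mono_ac hac
  obtain ⟨B, hB⟩ := hosc.exists_abs_le
  set r : ℝ := 2 * N * ε with hr
  have hr0 : 0 ≤ r := by positivity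
  have hmgf := h.integral_exp_mul_le_of_integrable hN' (hg.const_mul r) (hosc.const_mul hr0)
  have hmean : ∫ x, r * g x * ρ x = r * ∫ y, g y ∂μ := by
    rw [hint, ← integral_const_mul]
    simp only [mul_assoc]
  rw [hZ, ← hint fun x => Real.exp (r * g x), hmean, one_mul, div_one] at hmgf
  have hexpint : Integrable (fun x => Real.exp (r * (g x - ∫ y, g y ∂μ))) μ := by
    refine Integrable.of_bound (C := Real.exp (r * (B - ∫ y, g y ∂μ)))
      (Real.continuous_exp.comp_aestronglyMeasurable
        ((hgm.sub aestronglyMeasurable_const).const_mul r)) (Filter.Eventually.of_forall fun x => ?_)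
    rw [Real.norm_eq_abs, Real.abs_exp]
    exact Real.exp_le_exp.2 (mul_le_mul_of_nonneg_left
      (sub_le_sub_right ((le_abs_self _).trans (hB x)) _) hr0)
  refine (ProbabilityTheory.measure_ge_le_exp_mul_mgf ε hr0 hexpint).trans ?_
  have hshift : ProbabilityTheory.mgf (fun x => g x - ∫ y, g y ∂μ) μ r =
      Real.exp (-(r * ∫ y, g y ∂μ)) * ∫ x, Real.exp (r * g x) ∂μ := by
    rw [ProbabilityTheory.mgf, ← integral_const_mul]
    congr 1; ext x
    rw [← Real.exp_add]; ring_nf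
  rw [hshift]
  refine (mul_le_mul_of_nonneg_left (mul_le_mul_of_nonneg_left hmgf (Real.exp_pos _).le)
    (Real.exp_pos _).le).trans ?_
  rw [← Real.exp_add, ← Real.exp_add, Real.exp_le_exp]
  have hS : (r * (N : ℝ)⁻¹) ^ 2 * ((N + N + 1) * N / (N + 1)) / 8 ≤ ε ^ 2 * N := by
    have : ((N : ℝ) + N + 1) * N / (N + 1) ≤ 2 * N := by
      rw [div_le_iff₀ (by positivity)]
      nlinarith
    have hrN : r * (N : ℝ)⁻¹ = 2 * ε := by rw [hr]; field_simp
    rw [hrN]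
    have := mul_le_mul_of_nonneg_left this (sq_nonneg (2 * ε))
    linarith
  have hrε : r * ε = 2 * (ε ^ 2 * N) := by rw [hr]; ring
  linarith

end Concentration

theorem mainTheorem5 (a b : ℝ) (ha : 0 < a) (hab : a ≤ b) :
    ∃ K : ℝ, 0 < K ∧ ∀ N : ℕ, 1 ≤ N →
      ∀ μ ∈ quasiProductMeasures N a b (N : ℝ)⁻¹, IsProbabilityMeasure μ →
      ∀ g ∈ smallOsc N (N : ℝ)⁻¹,
        Integrable g μ ∧
        ∀ ε : ℝ, 0 < ε →
          μ.real {x | ε ≤ |g x - ∫ y, g y ∂μ|} ≤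
            2 * Real.exp (-(ε ^ 2 * N / (1 + K / N))) := by
  refine ⟨1, one_pos, fun N hN μ hμ hprob g hg => ?_⟩
  obtain ⟨ρ, hm, hpos, hμρ, hlip⟩ := hμ
  have hN' : (0 : ℝ) < N := by exact_mod_cast hN
  have hosc : HasCoordOscLE (N : ℝ)⁻¹ g := hasCoordOscLE_of_mem_smallOsc (by positivity) hg
  obtain ⟨B, hB⟩ := hosc.exists_abs_le
  have hac : μ ≪ volume := hμρ ▸ withDensity_absolutelyContinuous _ _
  have hgμ : Integrable g μ := Integrable.of_bound (hg.2.aestronglyMeasurable.mono_ac hac) B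
    (Filter.Eventually.of_forall hB)
  refine ⟨hgμ, fun ε hε => ?_⟩
  rcases hN.eq_or_lt with rfl | hN2
  -- For `N = 1` no coupling condition is available, but `|g - E g| ≤ 1`, and the right-hand side
  -- is at least `2 exp (-1 / 2) ≥ 1` when `ε ≤ 1`.
  · rcases le_or_gt ε 1 with hε1 | hε1
    · refine measureReal_le_one.trans ?_
      have h1 : ε ^ 2 * ((1 : ℕ) : ℝ) / (1 + 1 / ((1 : ℕ) : ℝ)) ≤ 1 / 2 := by
        norm_num
        nlinarith
      have h2 := Real.add_one_le_exp (-(ε ^ 2 * ((1 : ℕ) : ℝ) / (1 + 1 / ((1 : ℕ) : ℝ))))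
      linarith
    · have hempty : {x | ε ≤ |g x - ∫ y, g y ∂μ|} = ∅ := by
        refine Set.eq_empty_of_forall_notMem fun x hx => ?_
        have hle : ∀ x y, g x ≤ g y + 1 := fun x y => by simpa using hosc.le_add x y
        have h1 : g x - 1 ≤ ∫ y, g y ∂μ := by
          simpa using integral_mono (integrable_const (g x - 1)) hgμ fun y => by
            have := hle x y
            simp only
            linarith
        have h2 : ∫ y, g y ∂μ ≤ g x + 1 := by
          simpa using integral_mono hgμ (integrable_const (g x + 1)) fun y => hle y x
        have h3 : |g x - ∫ y, g y ∂μ| ≤ 1 := abs_le.2 ⟨by linarith, by linarith⟩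
        exact absurd (hx.trans h3) (not_le.2 hε1)
      rw [hempty, measureReal_empty]
      positivity
  · have hwc : IsWeaklyCoupled (1 / ((N : ℝ) + N)) ρ := by
      have := isWeaklyCoupled_of_isLipDisintegrated hN2 ha hab (inv_pos.2 hN').le hm hpos hlip
      convert this using 1
      field_simp
      norm_num
    have hup := measureReal_deviation_le hN hμρ hwc hg.2 hosc hε
    have hdown := measureReal_deviation_le hN hμρ hwc hg.2.neg hosc.neg hε
    have hsub : {x | ε ≤ |g x - ∫ y, g y ∂μ|} ⊆ {x | ε ≤ g x - ∫ y, g y ∂μ} ∪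
        {x | ε ≤ (-g) x - ∫ y, (-g) y ∂μ} := fun x hx => by
      simp only [Set.mem_union, Set.mem_ofPred_eq, Pi.neg_apply, integral_neg] at hx ⊢
      rcases le_abs.1 hx with h | h
      · exact Or.inl h
      · right; linarith
    have hexp : Real.exp (-(ε ^ 2 * N)) ≤ Real.exp (-(ε ^ 2 * N / (1 + 1 / N))) := by
      refine Real.exp_le_exp.2 (neg_le_neg (div_le_self (by positivity) ?_))
      have : 0 ≤ 1 / (N : ℝ) := by positivity
      linarith
    calc μ.real {x | ε ≤ |g x - ∫ y, g y ∂μ|}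
        ≤ μ.real {x | ε ≤ g x - ∫ y, g y ∂μ} + μ.real {x | ε ≤ (-g) x - ∫ y, (-g) y ∂μ} :=
          (measureReal_mono hsub).trans (measureReal_union_le _ _)
      _ ≤ 2 * Real.exp (-(ε ^ 2 * N / (1 + 1 / N))) := by linarith
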